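/- Let $\mathcal X$ be a finite-dimensional Euclidean space, and let $f:\mathcal X\to[0,+\infty]$ be proper, closed (lower semicontinuous) and convex, with $\inf f>0$ and $\operatorname{argmin} f\neq\emptyset$. Let $f_\infty$ be the recession function of $f$, i.e. the function whose epigraph is the recession cone of the epigraph of $f$, and let $$f^\pi(x,\lambda)=\begin{cases}\lambda f(\lambda^{-1}x)&\text{if }\lambda>0,\\ f_\infty(x)&\text{if }\lambda=0,\\ +\infty&\text{if }\lambda<0,\end{cases}\qquad (x,\lambda)\in\mathcal X\times\mathbb R,$$ be the closed perspective of $f$. For $\alpha>0$ and $x\in\mathcal X$, let $$P_{\alpha,f}(x)=\operatorname*{argmin}_{(z,s)\in\mathcal X\times\mathbb R}\ \max\Big\{f^\pi(z,s),\ \tfrac1\alpha\,\big\|(x,1)-(z,s)\big\|_2\Big\}$$ be the projected polar proximal map of $f$ at $x$, where $\|(u,t)\|_2=\sqrt{\|u\|^2+t^2}$. **Theorem** (Projected fixed points of the projected polar proximal map). Let $\alpha>0$. 1. If $x\in\mathcal X$ and $\lambda\in\mathbb R$ satisfy $(x,\lambda)\in P_{\alpha,f}(x)$ (in particular, if $P_{\alpha,f}(x)=\{(x,\lambda)\}$),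 then $\lambda>0$ and $\lambda^{-1}x\in\operatorname{argmin} f$. 2. If $x\in\operatorname{argmin} f$, then there exists $\lambda>0$ such that $P_{\alpha,f}(\tau x)=\{(\tau x,\lambda)\}$, where $\tau=[1+\alpha f(x)]^{-1}$. -/

import Mathlib

open scoped ENNReal NNReal

noncomputable section

namespace PolarProx

/-- The set of (global) minimizers of `f`. -/
def argmin {E : Type*} (f : E → ℝ≥0∞) : Set E := {x | IsMinOn f Set.univ x}

/-- The epigraph of a function with values in `[0, +∞]`, as a subset of `X × ℝ`. The condition
`0 ≤ p.2` is there because `ENNReal.ofReal` sends negative reals to `0`. -/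
def epigraph {X : Type*} (f : X → ℝ≥0∞) : Set (X × ℝ) :=
  {p | 0 ≤ p.2 ∧ f p.1 ≤ ENNReal.ofReal p.2}

/-- The recession function of `f`: the function whose epigraph is the recession (asymptotic) cone
of the epigraph of `f`. -/
def recession {X : Type*} [NormedAddCommGroup X] [NormedSpace ℝ X] (f : X → ℝ≥0∞) (d : X) : ℝ≥0∞ :=
  ⨅ (r : ℝ≥0) (_ : (d, (r : ℝ)) ∈ asymptoticCone ℝ (epigraph f)), (r : ℝ≥0∞)

/-- The closed perspective of `f`, on the product `X × ℝ` with the Euclidean norm. -/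
def perspective {X : Type*} [NormedAddCommGroup X] [NormedSpace ℝ X] (f : X → ℝ≥0∞)
    (p : WithLp 2 (X × ℝ)) : ℝ≥0∞ :=
  if 0 < p.snd then ENNReal.ofReal p.snd * f (p.snd⁻¹ • p.fst)
  else if p.snd = 0 then recession f p.fst
  else ∞

/-- The polar proximal map of `α κ` at `x`: the set of minimizers of
`z ↦ max {κ z, (1/α) ‖x - z‖}`. -/
def polarProx {E : Type*} [NormedAddCommGroup E] (α : ℝ) (κ : E → ℝ≥0∞) (x : E) : Set E :=
  argmin fun z => max (κ z) (ENNReal.ofReal (1 / α * ‖x - z‖))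

/-- The projected polar proximal map of `f` at `x`: the polar proximal map of the perspective
of `f` at `(x, 1)`. -/
def projPolarProx {X : Type*} [NormedAddCommGroup X] [NormedSpace ℝ X] (α : ℝ) (f : X → ℝ≥0∞)
    (x : X) : Set (WithLp 2 (X × ℝ)) :=
  polarProx α (perspective f) (WithLp.toLp 2 (x, 1))

end PolarProx

end

open Filter Topology

namespace PolarProx

/-! ### Recession directions of the epigraph. -/

section Epigraph

/-! For part 1, take `y` in `argmin f` and perturb `(x, l)` to `(1 - εT)(x, l) + εS(y, 1)`.
Sublinearity bounds the perspective. Since the centre is `(x, 1)`, the `X`-displacement changes the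
distance only to second order, so its variation is governed by the height. If `l ≥ 1`, or `l = 0`,
or `l⁻¹ • x` is not a minimizer, some `T, S` beat the supposed minimum
(`not_eventually_lt_of_mem_projPolarProx`). For part 2, `τ` balances the two terms: the distance
bounds the height below by `τ`, the perspective bounds it above (`eq_of_objective_le`). -/

theorem isClosed_epigraph {X : Type*} [TopologicalSpace X] {f : X → ℝ≥0∞}
    (hf : LowerSemicontinuous f) : IsClosed (epigraph f) := by
  have h2 : IsClosed {p : X × ℝ | f p.1 ≤ ENNReal.ofReal p.2} :=
    hf.isClosed_epigraph.preimage
      (continuous_fst.prodMk (ENNReal.continuous_ofReal.comp continuous_snd) :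
        Continuous fun p : X × ℝ => (p.1, ENNReal.ofReal p.2))
  exact (isClosed_le continuous_const continuous_snd).inter h2

variable {X : Type*} [NormedAddCommGroup X] [NormedSpace ℝ X] {f : X → ℝ≥0∞}

theorem apply_add_le_of_convexOn (hf : ConvexOn ℝ≥0 Set.univ f) {x y : X} {a b : ℝ}
    (ha : 0 ≤ a) (hb : 0 ≤ b) (hab : a + b = 1) :
    f (a • x + b • y) ≤ ENNReal.ofReal a * f x + ENNReal.ofReal b * f y := by
  lift a to ℝ≥0 using ha
  lift b to ℝ≥0 using hb
  have := hf.2 (Set.mem_univ x) (Set.mem_univ y) zero_le zero_le (by exact_mod_cast hab)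
  simpa [ENNReal.smul_def, NNReal.smul_def] using this

theorem convex_epigraph (hf : ConvexOn ℝ≥0 Set.univ f) : Convex ℝ (epigraph f) := by
  rintro ⟨x, r⟩ ⟨hr, hx⟩ ⟨y, q⟩ ⟨hq, hy⟩ a b ha hb hab
  simp only at hr hx hq hy
  refine ⟨by simp only [Prod.smul_mk, Prod.mk_add_mk, smul_eq_mul]; positivity, ?_⟩
  simp only [Prod.smul_mk, Prod.mk_add_mk, smul_eq_mul]
  refine (apply_add_le_of_convexOn hf ha hb hab).trans ?_
  rw [ENNReal.ofReal_add (by positivity) (by positivity), ENNReal.ofReal_mul ha,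
    ENNReal.ofReal_mul hb]
  gcongr

/-- A closed convex epigraph is stable under translation by its asymptotic cone. -/
theorem apply_smul_add_le_recession (hc : LowerSemicontinuous f) (hf : ConvexOn ℝ≥0 Set.univ f)
    {c : ℝ} (hc0 : 0 < c) (d y : X) :
    f (c • d + y) ≤ ENNReal.ofReal c * recession f d + f y := by
  by_cases hy : f y = ∞
  · simp [hy]
  -- Isolating `recession f d` reduces the claim to one slope `r` at a time.
  rw [← tsub_le_iff_right, mul_comm]
  refine (ENNReal.div_le_iff_le_mul (by simp [hc0]) (by simp)).1 ?_
  refine le_iInf₂ fun r hr => ?_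
  refine ENNReal.div_le_of_le_mul (tsub_le_iff_right.2 ?_)
  have hmem : (y, (f y).toReal) ∈ epigraph f := ⟨ENNReal.toReal_nonneg, by simp [hy]⟩
  have h := ((convex_epigraph hf).smul_vadd_mem_of_isClosed_of_mem_asymptoticCone
    (isClosed_epigraph hc) hc0.le hr hmem).2
  simp only [vadd_eq_add, Prod.smul_mk, Prod.mk_add_mk, smul_eq_mul] at h
  rw [ENNReal.ofReal_add (by positivity) ENNReal.toReal_nonneg, ENNReal.ofReal_mul hc0.le,
    ENNReal.ofReal_toReal hy, ENNReal.ofReal_coe_nnreal] at h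
  rwa [mul_comm]

end Epigraph

/-! ### Sublinearity of the perspective. -/

section Perspective

variable {X : Type*} [NormedAddCommGroup X] [NormedSpace ℝ X] {f : X → ℝ≥0∞}

theorem perspective_of_pos (x : X) {l : ℝ} (hl : 0 < l) :
    perspective f (WithLp.toLp 2 (x, l)) = ENNReal.ofReal l * f (l⁻¹ • x) := by
  simp [perspective, hl]

theorem perspective_zero (x : X) :
    perspective f (WithLp.toLp 2 (x, (0 : ℝ))) = recession f x := by
  simp [perspective]

theorem nonneg_of_perspective_ne_top {x : X} {l : ℝ}
    (h : perspective f (WithLp.toLp 2 (x, l)) ≠ ∞) : 0 ≤ l := by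
  by_contra! hl
  exact h (by simp [perspective, hl.not_gt, hl.ne])

/-- `hls` keeps the combined point at positive height, so the recession function enters only through
`l = 0`. -/
theorem perspective_smul_add_smul_le (hc : LowerSemicontinuous f)
    (hf : ConvexOn ℝ≥0 Set.univ f) (x y : X) {l a s : ℝ} (hl : 0 ≤ l) (ha : 0 < a) (hs : 0 ≤ s)
    (hls : 0 < l ∨ 0 < s) :
    perspective f (WithLp.toLp 2 (a • x + s • y, a * l + s)) ≤
      ENNReal.ofReal a * perspective f (WithLp.toLp 2 (x, l)) + ENNReal.ofReal s * f y := by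
  rcases hl.eq_or_lt with rfl | hl
  · have hs : 0 < s := by simpa using hls
    rw [mul_zero, zero_add, perspective_of_pos _ hs, perspective_zero]
    have h : s⁻¹ • (a • x + s • y) = (s⁻¹ * a) • x + y := by
      rw [smul_add, smul_smul, inv_smul_smul₀ hs.ne']
    rw [h]
    calc _ ≤ ENNReal.ofReal s * (ENNReal.ofReal (s⁻¹ * a) * recession f x + f y) := by
          gcongr
          exact apply_smul_add_le_recession hc hf (by positivity) x y
      _ = _ := by
          rw [mul_add, ← mul_assoc, ← ENNReal.ofReal_mul hs.le, mul_inv_cancel_left₀ hs.ne']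
  · have hw : 0 < a * l + s := by positivity
    rw [perspective_of_pos _ hw, perspective_of_pos _ hl]
    have h : (a * l + s)⁻¹ • (a • x + s • y) =
        ((a * l + s)⁻¹ * (a * l)) • (l⁻¹ • x) + ((a * l + s)⁻¹ * s) • y := by
      rw [smul_add, smul_smul, smul_smul, smul_smul]
      congr 2
      field_simp
    rw [h]
    calc _ ≤ ENNReal.ofReal (a * l + s) * (ENNReal.ofReal ((a * l + s)⁻¹ * (a * l)) * f (l⁻¹ • x)
            + ENNReal.ofReal ((a * l + s)⁻¹ * s) * f y) := by
          gcongr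
          exact apply_add_le_of_convexOn hf (by positivity) (by positivity) (by field_simp)
      _ = _ := by
          rw [mul_add, ← mul_assoc (ENNReal.ofReal _), ← mul_assoc (ENNReal.ofReal _),
            ← ENNReal.ofReal_mul hw.le, ← ENNReal.ofReal_mul hw.le, mul_inv_cancel_left₀ hw.ne', mul_inv_cancel_left₀ hw.ne',
            ENNReal.ofReal_mul ha.le, mul_assoc]

end Perspective

/-! ### First-order perturbation of a minimizer. -/

section Perturbation

/-- The squared root has derivative `2 * e * δ < 0` at `ε = 0`; `k` enters only at order `ε ^ 2`. -/
theorem eventually_sqrt_lt_abs {e δ : ℝ} (k : ℝ) (h : e * δ < 0) :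
    ∀ᶠ ε in 𝓝[>] (0 : ℝ), √((ε * k) ^ 2 + (e + ε * δ) ^ 2) < |e| := by
  have h1 : ∀ᶠ ε in 𝓝[>] (0 : ℝ), ε * (k ^ 2 + δ ^ 2) < -2 * (e * δ) :=
    nhdsWithin_le_nhds <| ContinuousAt.eventually_lt (by fun_prop) (by fun_prop) (by linarith)
  filter_upwards [h1, self_mem_nhdsWithin] with ε h1 (h2 : 0 < ε)
  rw [← Real.sqrt_sq_eq_abs]
  refine Real.sqrt_lt_sqrt (by positivity) ?_
  nlinarith [mul_lt_mul_of_pos_left h1 h2]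

theorem norm_toLp_sub_toLp {X : Type*} [NormedAddCommGroup X] (x z : X) (r s : ℝ) :
    ‖WithLp.toLp 2 (x, r) - WithLp.toLp 2 (z, s)‖ = √(‖x - z‖ ^ 2 + (r - s) ^ 2) := by
  rw [← WithLp.toLp_sub, WithLp.prod_norm_eq_of_L2]
  simp

variable {X : Type*} [NormedAddCommGroup X] [InnerProductSpace ℝ X] {f : X → ℝ≥0∞}

/-- No direction at a minimizer decreases both terms of the objective below its value. -/
theorem not_eventually_lt_of_mem_projPolarProx (hc : LowerSemicontinuous f)
    (hf : ConvexOn ℝ≥0 Set.univ f) {α : ℝ} {x y : X} {l T S : ℝ}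
    (hmem : WithLp.toLp 2 (x, l) ∈ projPolarProx α f x)
    (hx : perspective f (WithLp.toLp 2 (x, l)) ≠ ∞) (hy : f y ≠ ∞) (hS : 0 ≤ S)
    (hlS : 0 < l ∨ 0 < S)
    (h1 : ∀ᶠ ε in 𝓝[>] (0 : ℝ),
      (1 - ε * T) * (perspective f (WithLp.toLp 2 (x, l))).toReal + ε * S * (f y).toReal <
        max (perspective f (WithLp.toLp 2 (x, l))).toReal (1 / α * |1 - l|))
    (h2 : ∀ᶠ ε in 𝓝[>] (0 : ℝ),
      1 / α * √((ε * ‖T • x - S • y‖) ^ 2 + ((1 - l) + ε * (T * l - S)) ^ 2) <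
        max (perspective f (WithLp.toLp 2 (x, l))).toReal (1 / α * |1 - l|)) : False := by
  have h3 : ∀ᶠ ε in 𝓝[>] (0 : ℝ), ε * T < 1 :=
    nhdsWithin_le_nhds <| ContinuousAt.eventually_lt (by fun_prop) (by fun_prop) (by simp)
  obtain ⟨ε, h1, h2, h3, hε : 0 < ε⟩ := (h1.and (h2.and (h3.and self_mem_nhdsWithin))).exists
  have ha : 0 < 1 - ε * T := by linarith
  have hs : 0 ≤ ε * S := by positivity
  have hP := perspective_smul_add_smul_le hc hf x y (nonneg_of_perspective_ne_top hx) ha hs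
    (hlS.imp_right fun h => by positivity)
  have hN : ‖WithLp.toLp 2 (x, (1 : ℝ)) -
      WithLp.toLp 2 ((1 - ε * T) • x + (ε * S) • y, (1 - ε * T) * l + ε * S)‖ =
      √((ε * ‖T • x - S • y‖) ^ 2 + ((1 - l) + ε * (T * l - S)) ^ 2) := by
    rw [norm_toLp_sub_toLp]
    have h : x - ((1 - ε * T) • x + (ε * S) • y) = ε • (T • x - S • y) := by module
    rw [h, norm_smul, Real.norm_of_nonneg hε.le]
    congr 2
    ring
  have hle := hmem (Set.mem_univ
    (WithLp.toLp 2 ((1 - ε * T) • x + (ε * S) • y, (1 - ε * T) * l + ε * S)))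
  simp only [Set.mem_ofPred_eq, hN] at hle
  rw [norm_toLp_sub_toLp, sub_self, norm_zero, zero_pow two_ne_zero, zero_add,
    Real.sqrt_sq_eq_abs] at hle
  set F := perspective f (WithLp.toLp 2 (x, l))
  have hpos := (le_max_left F.toReal (1 / α * |1 - l|)).trans' ENNReal.toReal_nonneg
  have hM : max F (ENNReal.ofReal (1 / α * |1 - l|)) =
      ENNReal.ofReal (max F.toReal (1 / α * |1 - l|)) := by
    rw [ENNReal.ofReal_max, ENNReal.ofReal_toReal hx]
  rw [hM] at hle
  refine absurd hle (not_le.2 (max_lt (hP.trans_lt ?_) ?_))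
  · nth_rw 1 [← ENNReal.ofReal_toReal hx, ← ENNReal.ofReal_toReal hy]
    rw [← ENNReal.ofReal_mul ha.le, ← ENNReal.ofReal_mul hs, ← ENNReal.ofReal_add (by positivity) (by positivity)]
    exact (ENNReal.ofReal_lt_ofReal_iff_of_nonneg (by positivity)).2 h1
  · refine ENNReal.ofReal_lt_ofReal_iff'.2 ⟨h2, ?_⟩
    refine hpos.lt_of_ne fun h => ?_
    have hF : 0 ≤ (1 - ε * T) * F.toReal + ε * S * (f y).toReal := by positivity
    linarith

theorem perspective_ne_top_of_mem_projPolarProx {α : ℝ} {x y : X} {l : ℝ} (hy : f y ≠ ∞)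
    (hmem : WithLp.toLp 2 (x, l) ∈ projPolarProx α f x) :
    perspective f (WithLp.toLp 2 (x, l)) ≠ ∞ := by
  have hle := hmem (Set.mem_univ (WithLp.toLp 2 (y, (1 : ℝ))))
  simp only [Set.mem_ofPred_eq, perspective_of_pos y one_pos] at hle
  refine ((le_max_left _ _).trans (hle.trans_eq rfl)).trans_lt ?_ |>.ne
  simp [hy.lt_top]

end Perturbation

/-! ### The two directions of the theorem. -/

section FixedPoints

variable {X : Type*} [NormedAddCommGroup X] [InnerProductSpace ℝ X] {f : X → ℝ≥0∞}

theorem pos_and_mem_argmin_of_mem_projPolarProx (hc : LowerSemicontinuous f)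
    (hf : ConvexOn ℝ≥0 Set.univ f) {α : ℝ} (hα : 0 < α) {x y : X} {l : ℝ}
    (hy : y ∈ argmin f) (hy0 : f y ≠ 0) (hyt : f y ≠ ∞)
    (hmem : WithLp.toLp 2 (x, l) ∈ projPolarProx α f x) :
    0 < l ∧ l⁻¹ • x ∈ argmin f := by
  have hx := perspective_ne_top_of_mem_projPolarProx hyt hmem
  have hl := nonneg_of_perspective_ne_top hx
  have key := fun {T S : ℝ} => not_eventually_lt_of_mem_projPolarProx (T := T) (S := S) hc hf hmem
    hx hyt
  have hm : 0 < (f y).toReal := ENNReal.toReal_pos hy0 hyt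
  have hmin : ∀ z, f y ≤ f z := fun z => hy (Set.mem_univ z)
  set F := (perspective f (WithLp.toLp 2 (x, l))).toReal with hF
  set m := (f y).toReal
  have hF0 : 0 ≤ F := ENNReal.toReal_nonneg
  have hi : 0 < 1 / α := by positivity
  have hFl : 0 < l → F = l * (f (l⁻¹ • x)).toReal ∧ f (l⁻¹ • x) ≠ ∞ := fun h => by
    rw [perspective_of_pos x h] at hF hx
    refine ⟨by rw [hF, ENNReal.toReal_mul, ENNReal.toReal_ofReal hl], fun ht => hx ?_⟩
    rw [ht, ENNReal.mul_top (by simpa using h)]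
  rcases lt_or_ge l 1 with hl1 | hl1
  · have hnorm : ∀ {T S : ℝ} (k : ℝ), T * l < S → ∀ᶠ ε in 𝓝[>] (0 : ℝ),
        1 / α * √((ε * k) ^ 2 + ((1 - l) + ε * (T * l - S)) ^ 2) < max F (1 / α * |1 - l|) :=
      fun {T S} k h => by
        filter_upwards [eventually_sqrt_lt_abs (e := 1 - l) (δ := T * l - S) k
          (mul_neg_of_pos_of_neg (by linarith) (by linarith))] with ε hε
        exact lt_max_of_lt_right (mul_lt_mul_of_pos_left hε hi)
    rcases lt_or_ge (l * m) F with hlt | hge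
    -- `l < S` shortens the distance, while `S * m < F` lowers the perspective.
    · obtain ⟨S, hS1, hS2⟩ := exists_between ((lt_div_iff₀ hm).2 hlt)
      rw [lt_div_iff₀ hm] at hS2
      refine (key (T := 1) (hl.trans hS1.le) (.inr (hl.trans_lt hS1)) ?_
        (hnorm _ (by linarith))).elim
      filter_upwards [self_mem_nhdsWithin] with ε (hε : 0 < ε)
      refine lt_max_of_lt_left ?_
      nlinarith [mul_lt_mul_of_pos_left hS2 hε]
    · rcases hl.eq_or_lt with hl0 | hl0
      -- Here the objective is `1 / α`; adding `ε(y, 1)` shortens the distance and costs only `ε *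
      -- m` in the perspective.
      · have hF1 : F = 0 := le_antisymm (by simpa [← hl0] using hge) hF0
        refine (key (T := 0) zero_le_one (.inr one_pos) ?_ (hnorm _ (by simp))).elim
        have h : 0 < max F (1 / α * |1 - l|) := lt_max_of_lt_right (by simp [← hl0, hα])
        rw [hF1] at h ⊢
        exact nhdsWithin_le_nhds <|
          ContinuousAt.eventually_lt (by fun_prop) (by fun_prop) (by simpa using h)
      · refine ⟨hl0, fun z _ => ?_⟩
        obtain ⟨h1, h2⟩ := hFl hl0
        rw [h1] at hge
        have h3 := le_of_mul_le_mul_left hge hl0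
        exact ((ENNReal.toReal_le_toReal h2 hyt).1 h3).trans (hmin z)
  · have hl0 : 0 < l := by linarith
    have hFpos : 0 < F := by
      obtain ⟨h1, h2⟩ := hFl hl0
      rw [h1]
      exact mul_pos hl0 (hm.trans_le (ENNReal.toReal_mono h2 (hmin _)))
    -- Shrinking towards the origin lowers `F`. The distance drops too if `l > 1`; if `l = 1` it
    -- starts at `0 < F` and continuity suffices.
    refine (key (T := 1) (S := 0) le_rfl (.inl hl0) ?_ ?_).elim
    · filter_upwards [self_mem_nhdsWithin] with ε (hε : 0 < ε)
      refine lt_max_of_lt_left ?_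
      nlinarith [mul_pos hε hFpos]
    · rcases hl1.eq_or_lt with rfl | hl1
      · refine nhdsWithin_le_nhds <|
          ContinuousAt.eventually_lt (by fun_prop) (by fun_prop) ?_
        exact lt_max_of_lt_left (by simpa using hFpos)
      · filter_upwards [eventually_sqrt_lt_abs (e := 1 - l) (δ := 1 * l - 0)
          ‖(1 : ℝ) • x - (0 : ℝ) • y‖ (mul_neg_of_neg_of_pos (by linarith) (by linarith))] with ε hε
        exact lt_max_of_lt_right (mul_lt_mul_of_pos_left hε hi)

theorem eq_of_objective_le {α : ℝ} (hα : 0 < α) {x : X} (hx : x ∈ argmin f) (hx0 : f x ≠ 0)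
    (hxt : f x ≠ ∞) {τ : ℝ} (hτ : τ = (1 + α * (f x).toReal)⁻¹) (q : WithLp 2 (X × ℝ))
    (hq : max (perspective f q) (ENNReal.ofReal (1 / α * ‖WithLp.toLp 2 (τ • x, (1 : ℝ)) - q‖)) ≤
      ENNReal.ofReal (τ * (f x).toReal)) :
    q = WithLp.toLp 2 (τ • x, τ) := by
  obtain ⟨⟨z, s⟩⟩ := q
  have hm : 0 < (f x).toReal := ENNReal.toReal_pos hx0 hxt
  set m := (f x).toReal
  have hτ0 : 0 < τ := by rw [hτ]; positivity
  have hτ1 : α * (τ * m) = 1 - τ := by rw [hτ]; field_simp; ring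
  obtain ⟨hP, hD⟩ := max_le_iff.1 hq
  rw [ENNReal.ofReal_le_ofReal_iff (by positivity), one_div, inv_mul_le_iff₀ hα, hτ1,
    norm_toLp_sub_toLp, Real.sqrt_le_iff] at hD
  obtain ⟨hD0, hD⟩ := hD
  have hs : τ ≤ s := by
    by_contra! hlt
    nlinarith [sq_nonneg ‖τ • x - z‖]
  have hs0 : 0 < s := hτ0.trans_le hs
  have hs' : s ≤ τ := by
    rw [perspective_of_pos z hs0] at hP
    have h : ENNReal.ofReal (s * m) ≤ ENNReal.ofReal (τ * m) := by
      refine le_trans ?_ hP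
      rw [ENNReal.ofReal_mul hs0.le, ENNReal.ofReal_toReal hxt]
      gcongr
      exact hx (Set.mem_univ _)
    rw [ENNReal.ofReal_le_ofReal_iff (by positivity)] at h
    exact le_of_mul_le_mul_right h hm
  obtain rfl : s = τ := le_antisymm hs' hs
  have hz : ‖s • x - z‖ ^ 2 = 0 := le_antisymm (by linarith) (sq_nonneg _)
  rw [pow_eq_zero_iff two_ne_zero, norm_eq_zero, sub_eq_zero] at hz
  rw [hz]

theorem projPolarProx_smul_eq_singleton {α : ℝ} (hα : 0 < α) {x : X} (hx : x ∈ argmin f)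
    (hx0 : f x ≠ 0) (hxt : f x ≠ ∞) {τ : ℝ} (hτ : τ = (1 + α * (f x).toReal)⁻¹) :
    projPolarProx α f (τ • x) = {WithLp.toLp 2 (τ • x, τ)} := by
  have hm : 0 < (f x).toReal := ENNReal.toReal_pos hx0 hxt
  have hτ0 : 0 < τ := by rw [hτ]; positivity
  have hτ1 : α * (τ * (f x).toReal) = 1 - τ := by rw [hτ]; field_simp; ring
  have hval : max (perspective f (WithLp.toLp 2 (τ • x, τ))) (ENNReal.ofReal
      (1 / α * ‖WithLp.toLp 2 (τ • x, (1 : ℝ)) - WithLp.toLp 2 (τ • x, τ)‖)) =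
      ENNReal.ofReal (τ * (f x).toReal) := by
    have h : 0 ≤ 1 - τ := by rw [← hτ1]; positivity
    rw [perspective_of_pos _ hτ0, inv_smul_smul₀ hτ0.ne', norm_toLp_sub_toLp, sub_self, norm_zero,
      zero_pow two_ne_zero, zero_add, Real.sqrt_sq h, ← hτ1, one_div, inv_mul_cancel_left₀ hα.ne',
      ENNReal.ofReal_mul hτ0.le, ENNReal.ofReal_toReal hxt, max_self]
  ext q
  rw [Set.mem_singleton_iff]
  constructor
  · intro hq
    exact eq_of_objective_le hα hx hx0 hxt hτ q
      ((hq (Set.mem_univ (WithLp.toLp 2 (τ • x, τ)))).trans_eq hval)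
  · rintro rfl q -
    simp only [Set.mem_ofPred_eq]
    rw [hval]
    by_contra! hlt
    have hq := eq_of_objective_le hα hx hx0 hxt hτ q hlt.le
    rw [hq, hval] at hlt
    exact hlt.false

end FixedPoints

end PolarProx

theorem mainTheorem5 {X : Type*} [NormedAddCommGroup X] [InnerProductSpace ℝ X]
    [FiniteDimensional ℝ X] (f : X → ℝ≥0∞)
    (hf_proper : ∃ x, f x ≠ ∞)
    (hf_closed : LowerSemicontinuous f)
    (hf_convex : ConvexOn ℝ≥0 Set.univ f)
    (hf_inf : 0 < ⨅ x, f x)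
    (hf_argmin : (PolarProx.argmin f).Nonempty)
    (α : ℝ) (hα : 0 < α) :
    (∀ (x : X) (l : ℝ), WithLp.toLp 2 (x, l) ∈ PolarProx.projPolarProx α f x →
      0 < l ∧ l⁻¹ • x ∈ PolarProx.argmin f) ∧
    (∀ x ∈ PolarProx.argmin f, ∀ τ : ℝ, τ = (1 + α * (f x).toReal)⁻¹ →
      ∃ l : ℝ, 0 < l ∧ PolarProx.projPolarProx α f (τ • x) = {WithLp.toLp 2 (τ • x, l)}) := by
  have hpos : ∀ y, f y ≠ 0 := fun y => (hf_inf.trans_le (iInf_le f y)).ne'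
  have hfin : ∀ y ∈ PolarProx.argmin f, f y ≠ ∞ := fun y hy => by
    obtain ⟨z, hz⟩ := hf_proper
    exact ne_top_of_le_ne_top hz (hy (Set.mem_univ z))
  refine ⟨fun x l hmem => ?_, fun x hx τ hτ => ⟨τ, ?_, ?_⟩⟩
  · obtain ⟨y, hy⟩ := hf_argmin
    exact PolarProx.pos_and_mem_argmin_of_mem_projPolarProx hf_closed hf_convex hα hy (hpos y)
      (hfin y hy) hmem
  · rw [hτ]
    positivity
  · exact PolarProx.projPolarProx_smul_eq_singleton hα hx (hpos x) (hfin x hx) hτ
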